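/- Let $a,b$ be positive real numbers. For $z\in\mathbb C$, $|z|\le 1$, let $$\gamma_{a,b}(z)=\sum_{n=0}^{\infty}\left(\frac1{an+b}-\log\frac{an+b+1}{an+b}\right)z^n .$$ This series converges, and $\gamma_{a,b}$ has an analytic continuation to $\mathbb C\setminus[1,+\infty)$, denoted by the same symbol. For $u>0$ let $\Phi(z,s,u)$ be the Lerch transcendent: the function of $(z,s)$, holomorphic on $(\mathbb C\setminus[1,+\infty))\times\mathbb C$, which is the analytic continuation of the series $\sum_{n=0}^{\infty}z^n/(n+u)^s$, $|z|<1$, $s\in\mathbb C$; this continuation exists. Let $\psi(x)=\frac{d}{dx}\log\Gamma(x)$. Then $$\gamma_{a,b}(1)=\log\Gamma\Bigl(\frac{b+1}{a}\Bigr)-\log\Gamma\Bigl(\frac{b}{a}\Bigr)-\frac1a\,\psi\Bigl(\frac{b}{a}\Bigr),$$ and for every $z\in\mathbb C\setminus[1,+\infty)$ $$\gamma_{a,b}(z)=\frac1a\Phi\Bigl(z,1,\frac ba\Bigr)-\frac{\partial\Phi}{\partial s}\Bigl(z,0,\frac ba\Bigr)+\frac{\partial\Phi}{\partial s}\Bigl(z,0,\frac{b+1}a\Bigr)$$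 and $$\begin{aligned}\gamma_{a,b}'(z)={}&-\frac b{a^2}\Phi\Bigl(z,1,\frac ba+1\Bigr)+\frac1{a(1-z)}+\frac ba\,\frac{\partial\Phi}{\partial s}\Bigl(z,0,\frac ba+1\Bigr)-\frac{\partial\Phi}{\partial s}\Bigl(z,-1,\frac ba+1\Bigr)\\&-\frac{b+1}a\,\frac{\partial\Phi}{\partial s}\Bigl(z,0,\frac{b+1}a+1\Bigr)+\frac{\partial\Phi}{\partial s}\Bigl(z,-1,\frac{b+1}a+1\Bigr).\end{aligned}$$ -/

import Mathlib

noncomputable section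

namespace EulerLerch

/-- The cut plane `ℂ ∖ [1, +∞)`. -/
def cutPlane : Set ℂ := ((fun x : ℝ => (x : ℂ)) '' Set.Ici 1)ᶜ

/-- The coefficient `1 / (a n + b) - log ((a n + b + 1) / (a n + b))`. -/
def coeff (a b : ℝ) (n : ℕ) : ℝ :=
  1 / (a * n + b) - Real.log ((a * n + b + 1) / (a * n + b))

/-- `g` is an analytic continuation to `ℂ ∖ [1, +∞)` of the power series
`∑ (1 / (a n + b) - log ((a n + b + 1) / (a n + b))) z ^ n`. Since `ℂ ∖ [1, +∞)` is open and
connected, `g` is determined on it by this property. -/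
def IsGammaContinuation (a b : ℝ) (g : ℂ → ℂ) : Prop :=
  DifferentiableOn ℂ g cutPlane ∧
    ∀ z : ℂ, ‖z‖ < 1 → HasSum (fun n : ℕ => (coeff a b n : ℂ) * z ^ n) (g z)

open scoped Classical in
/-- The generalized-Euler-constant function `γ_{a,b}(z)`: the sum of its defining series for
`‖z‖ ≤ 1`, and the analytic continuation of that series to `ℂ ∖ [1, +∞)` elsewhere. -/
def gammaFun (a b : ℝ) (z : ℂ) : ℂ :=
  if ‖z‖ ≤ 1 then ∑' n : ℕ, (coeff a b n : ℂ) * z ^ n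
  else Classical.epsilon (IsGammaContinuation a b) z

/-- `F (z, s)` is an analytic continuation of the series `∑ z ^ n / (n + u) ^ s` to all
`z ∈ ℂ ∖ [1, +∞)` and all `s ∈ ℂ`, holomorphic in the two variables jointly. Since
`(ℂ ∖ [1, +∞)) × ℂ` is open and connected, `F` is determined on it by this property. -/
def IsLerchContinuation (u : ℝ) (F : ℂ × ℂ → ℂ) : Prop :=
  DifferentiableOn ℂ F (cutPlane ×ˢ Set.univ) ∧
    ∀ z s : ℂ, ‖z‖ < 1 → HasSum (fun n : ℕ => z ^ n / (((n + u : ℝ) : ℂ) ^ s)) (F (z, s))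

/-- The Lerch transcendent `Φ(z, s, u)`, for `z ∈ ℂ ∖ [1, +∞)`, `s ∈ ℂ` and `u > 0`. -/
def lerchPhi (z s : ℂ) (u : ℝ) : ℂ :=
  Classical.epsilon (IsLerchContinuation u) (z, s)

/-- The partial derivative `(∂Φ/∂s)(z, s, u)`. -/
def lerchPhiDeriv (z s : ℂ) (u : ℝ) : ℂ :=
  deriv (fun w : ℂ => lerchPhi z w u) s

end EulerLerch

end

noncomputable section

namespace EulerLerch

open MeasureTheory Filter Metric Set
open scoped Topology

/-! Put u = b/a and v = (b+1)/a. The coefficient of z^n equals (1/a)/(n+u) + log(n+u) - log(n+v),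
and -log x is the derivative of x^(-s) at s = 0. Hence in the unit disc both formulas compare power
series coefficient by coefficient, and the identity theorem (`eqOn_cutPlane`) carries them to the
cut plane, which is star-shaped about 0.

This needs a jointly holomorphic Φ. For Re s > 0 it is a Mellin transform divided by Γ(s)
(`isHalfLerch_lerchMellin`). The operator z∂/∂z + u then extends it leftwards by one unit in s at a
time (`IsHalfLerch.shift`), and the extensions glue by uniqueness. Two facts on two variables
support this: dominated integrals and directional derivatives of holomorphic functions are
holomorphic.

At z = 1 the partial sums are a combination of the Bohr–Mollerup sequences for log Γ at u and v and
of a sequence tending to ψ(u) (`hasSum_coeff`). -/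

/-! ### Holomorphic functions of two variables. -/

/-- Cauchy's estimate on the complex line through x in direction v. The radius r / (2‖v‖) keeps the
closed disc inside the open ball, whence the factor 2. -/
lemma norm_fderiv_le_of_forall_ball {E : Type*} [NormedAddCommGroup E] [NormedSpace ℂ E]
    {f : E → ℂ} {x : E} {r C : ℝ} (hr : 0 < r)
    (hf : DifferentiableOn ℂ f (ball x r)) (hC : ∀ y ∈ ball x r, ‖f y‖ ≤ C) :
    ‖fderiv ℂ f x‖ ≤ 2 * C / r := by
  have hC0 : 0 ≤ C := (norm_nonneg _).trans (hC x (mem_ball_self hr))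
  refine ContinuousLinearMap.opNorm_le_bound _ (by positivity) fun v => ?_
  rcases eq_or_ne v 0 with rfl | hv
  · simp
  have hv' : 0 < ‖v‖ := norm_pos_iff.2 hv
  set R := r / (2 * ‖v‖) with hR
  have hR0 : 0 < R := by positivity
  have hmem : ∀ t ∈ closedBall (0 : ℂ) R, x + t • v ∈ ball x r := by
    intro t ht
    rw [mem_closedBall_zero_iff] at ht
    rw [mem_ball_iff_norm, add_sub_cancel_left, norm_smul]
    calc ‖t‖ * ‖v‖ ≤ R * ‖v‖ := by gcongr
      _ = r / 2 := by rw [hR]; field_simp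
      _ < r := by linarith
  have hfd : ∀ t ∈ closedBall (0 : ℂ) R, DifferentiableAt ℂ f (x + t • v) := fun t ht =>
    (hf _ (hmem t ht)).differentiableAt (isOpen_ball.mem_nhds (hmem t ht))
  have hline : ∀ t : ℂ, HasDerivAt (fun t : ℂ => x + t • v) v t := fun t => by
    simpa using ((hasDerivAt_id t).smul_const v).const_add x
  have hg : DifferentiableOn ℂ (fun t : ℂ => f (x + t • v)) (closedBall 0 R) := fun t ht =>
    ((hfd t ht).hasFDerivAt.comp_hasDerivAt t (hline t)).differentiableAt.differentiableWithinAt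
  have h0 : deriv (fun t : ℂ => f (x + t • v)) 0 = fderiv ℂ f x v := by
    have := (hfd 0 (mem_closedBall_self hR0.le)).hasFDerivAt.comp_hasDerivAt (0 : ℂ) (hline 0)
    simpa [Function.comp_def] using this.deriv
  rw [← h0]
  refine (Complex.norm_deriv_le_of_forall_mem_sphere_norm_le hR0
    (hg.diffContOnCl_ball subset_rfl)
    fun z hz => hC _ (hmem z (sphere_subset_closedBall hz))).trans (le_of_eq ?_)
  rw [hR]; field_simp

/-- Integrals of dominated families of holomorphic functions of two variables are holomorphic. -/
lemma differentiableAt_integral_of_dominated {α : Type*} [MeasurableSpace α] {μ : Measure α}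
    {f : ℂ × ℂ → α → ℂ} {x₀ : ℂ × ℂ} {bound : α → ℝ} {r : ℝ} (hr : 0 < r)
    (hmeas : ∀ x ∈ ball x₀ r, AEStronglyMeasurable (f x) μ)
    (hdiff : ∀ᵐ a ∂μ, DifferentiableOn ℂ (fun x => f x a) (ball x₀ r))
    (hle : ∀ᵐ a ∂μ, ∀ x ∈ ball x₀ r, ‖f x a‖ ≤ bound a) (hint : Integrable bound μ) :
    DifferentiableAt ℂ (fun x => ∫ a, f x a ∂μ) x₀ := by
  have hdir : ∀ v : ℂ × ℂ,
      AEStronglyMeasurable (fun a => fderiv ℂ (fun x => f x a) x₀ v) μ := by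
    intro v
    -- With this scale every x₀ + v / c n lies in the ball. The directional derivative is then a
    -- limit of measurable difference quotients.
    set K : ℝ := (‖v‖ + 1) / r with hK
    have hK0 : 0 < K := by positivity
    set c : ℕ → ℂ := fun n => ((n + 1 : ℝ) * K : ℝ)
    have hcn : ∀ n, ‖c n‖ = (n + 1 : ℝ) * K := fun n => by
      simp only [c, Complex.norm_real, Real.norm_eq_abs]
      exact abs_of_pos (by positivity)
    have hc : Tendsto (fun n => ‖c n‖) atTop atTop := by
      simp only [hcn]
      exact (tendsto_atTop_add_const_right _ _ tendsto_natCast_atTop_atTop).atTop_mul_const hK0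
    have hmem : ∀ n, x₀ + (c n)⁻¹ • v ∈ ball x₀ r := by
      intro n
      rw [mem_ball_iff_norm, add_sub_cancel_left, norm_smul, norm_inv, hcn, inv_mul_lt_iff₀
        (by positivity), hK]
      have : (n + 1 : ℝ) * ((‖v‖ + 1) / r) * r = (n + 1) * (‖v‖ + 1) := by field_simp
      rw [this]
      nlinarith [norm_nonneg v, (Nat.cast_nonneg n : (0 : ℝ) ≤ n)]
    refine aestronglyMeasurable_of_tendsto_ae atTop
      (f := fun n a => c n • (f (x₀ + (c n)⁻¹ • v) a - f x₀ a)) (fun n => ?_) ?_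
    · exact ((hmeas _ (hmem n)).sub (hmeas _ (mem_ball_self hr))).const_smul (c n)
    · filter_upwards [hdiff] with a ha
      exact (ha.differentiableAt (ball_mem_nhds _ hr)).hasFDerivAt.lim v hc
  refine (hasFDerivAt_integral_of_dominated_of_fderiv_le (𝕜 := ℂ)
    (F' := fun x a => fderiv ℂ (fun x => f x a) x) (bound := fun a => 2 * bound a / (r / 2))
    (ball_mem_nhds x₀ (half_pos hr)) ?_ ?_ ?_ ?_ ?_ ?_).differentiableAt
  · filter_upwards [ball_mem_nhds x₀ hr] with x hx using hmeas x hx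
  · exact hint.mono' (hmeas _ (mem_ball_self hr))
      (hle.mono fun a ha => ha _ (mem_ball_self hr))
  -- Measurability of the full derivative reduces to that of its values on the two basis vectors.
  · have : (fun a => fderiv ℂ (fun x => f x a) x₀) = fun a =>
        (fderiv ℂ (fun x => f x a) x₀ (1, 0)) • ContinuousLinearMap.fst ℂ ℂ ℂ +
        (fderiv ℂ (fun x => f x a) x₀ (0, 1)) • ContinuousLinearMap.snd ℂ ℂ ℂ := by
      funext a
      ext <;> simp
    rw [this]
    exact ((hdir _).smul_const _).add ((hdir _).smul_const _)
  · filter_upwards [hdiff, hle] with a had hal x hx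
    have hsub : ball x (r / 2) ⊆ ball x₀ r := ball_subset_ball' (by
      have := mem_ball.1 hx
      linarith)
    exact norm_fderiv_le_of_forall_ball (half_pos hr) (had.mono hsub) fun y hy => hal y (hsub hy)
  · exact (hint.const_mul 2).div_const _
  · filter_upwards [hdiff] with a had x hx
    have hx' : x ∈ ball x₀ r := ball_subset_ball (half_le_self hr.le) hx
    exact (had.differentiableAt (isOpen_ball.mem_nhds hx')).hasFDerivAt

/-- Directional derivatives of holomorphic functions of two variables are holomorphic. -/
lemma differentiableOn_fderiv_apply {F : ℂ × ℂ → ℂ} {U : Set (ℂ × ℂ)} (hU : IsOpen U)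
    (hF : DifferentiableOn ℂ F U) (v : ℂ × ℂ) :
    DifferentiableOn ℂ (fun x => fderiv ℂ F x v) U := by
  intro x₀ hx₀
  refine DifferentiableAt.differentiableWithinAt ?_
  obtain ⟨ε, hε, hεU⟩ := Metric.isOpen_iff.1 hU x₀ hx₀
  obtain ⟨δ, hδ, hδb⟩ : ∃ δ > 0, ∀ y ∈ ball x₀ δ, ‖F y‖ ≤ ‖F x₀‖ + 1 := by
    have hc : ContinuousAt F x₀ := (hF.differentiableAt (hU.mem_nhds hx₀)).continuousAt
    have := hc.norm.eventually (Iio_mem_nhds (lt_add_one ‖F x₀‖))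
    obtain ⟨δ, hδ, h⟩ := Metric.eventually_nhds_iff_ball.1 this
    exact ⟨δ, hδ, fun y hy => (h y hy).le⟩
  set r := min ε δ / 2 with hr
  have hr0 : 0 < r := by positivity
  set R := r / (‖v‖ + 1) with hR
  have hR0 : 0 < R := by positivity
  have hmem' : ∀ x ∈ ball x₀ r, ∀ t ∈ closedBall (0 : ℂ) R, x + t • v ∈ ball x₀ (min ε δ) := by
    intro x hx t ht
    rw [mem_closedBall_zero_iff] at ht
    rw [mem_ball_iff_norm] at hx ⊢
    have h1 : ‖t • v‖ ≤ r := by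
      rw [norm_smul]
      calc ‖t‖ * ‖v‖ ≤ R * (‖v‖ + 1) := by gcongr; linarith
        _ = r := by rw [hR]; field_simp
    calc ‖x + t • v - x₀‖ = ‖(x - x₀) + t • v‖ := by congr 1; abel
      _ ≤ ‖x - x₀‖ + ‖t • v‖ := norm_add_le _ _
      _ < r + r := by linarith
      _ = min ε δ := by rw [hr]; ring
  have hmem : ∀ x ∈ ball x₀ r, ∀ t ∈ closedBall (0 : ℂ) R, x + t • v ∈ U := fun x hx t ht =>
    hεU (ball_subset_ball (min_le_left _ _) (hmem' x hx t ht))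
  have hline : ∀ x : ℂ × ℂ, ∀ t : ℂ, HasDerivAt (fun t : ℂ => x + t • v) v t := fun x t => by
    simpa using ((hasDerivAt_id t).smul_const v).const_add x
  have hFd : ∀ y ∈ U, DifferentiableAt ℂ F y := fun y hy => hF.differentiableAt (hU.mem_nhds hy)
  have hcd : ∀ x ∈ ball x₀ r, ∀ t ∈ closedBall (0 : ℂ) R,
      HasDerivAt (fun t : ℂ => F (x + t • v)) (fderiv ℂ F (x + t • v) v) t := fun x hx t ht =>
    (hFd _ (hmem x hx t ht)).hasFDerivAt.comp_hasDerivAt t (hline x t)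
  -- Cauchy's formula makes the derivative a circle integral of F, holomorphic in x by the dominated
  -- integral lemma.
  have key : ∀ x ∈ ball x₀ r, fderiv ℂ F x v =
      (2 * Real.pi * Complex.I : ℂ)⁻¹ • ∮ t in C(0, R), (t - 0)⁻¹ ^ 2 • F (x + t • v) := by
    intro x hx
    have hd : DifferentiableOn ℂ (fun t : ℂ => F (x + t • v)) (closedBall 0 R) := fun t ht =>
      (hcd x hx t ht).differentiableAt.differentiableWithinAt
    have h1 := hd.deriv_eq_smul_circleIntegral hR0
    have h2 := (hcd x hx 0 (mem_closedBall_self hR0.le)).deriv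
    rw [zero_smul, add_zero] at h2
    rw [← h2, eq_inv_smul_iff₀ Complex.two_pi_I_ne_zero, ← h1]
    simp only [one_div, inv_pow]
  have : DifferentiableAt ℂ (fun x : ℂ × ℂ => (2 * Real.pi * Complex.I : ℂ)⁻¹ •
      ∮ t in C(0, R), (t - 0)⁻¹ ^ 2 • F (x + t • v)) x₀ := by
    refine DifferentiableAt.fun_const_smul ?_ _
    simp only [circleIntegral, intervalIntegral.integral_of_le Real.two_pi_pos.le]
    have hcm : ∀ θ : ℝ, circleMap 0 R θ ∈ closedBall (0 : ℂ) R := fun θ =>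
      circleMap_mem_closedBall _ hR0.le _
    refine differentiableAt_integral_of_dominated
      (bound := fun _ => R * (R⁻¹ ^ 2 * (‖F x₀‖ + 1))) hr0 (fun x hx => ?_) ?_ ?_ ?_
    · refine Continuous.aestronglyMeasurable ?_
      have h1 : Continuous fun θ => F (x + circleMap 0 R θ • v) := by
        refine continuous_iff_continuousAt.2 fun θ => ?_
        exact ((hcd x hx _ (hcm θ)).continuousAt).comp (f := circleMap 0 R)
          (continuous_circleMap 0 R).continuousAt
      have h2 : Continuous fun θ => (circleMap 0 R θ - 0)⁻¹ := by
        simp only [sub_zero]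
        exact (continuous_circleMap 0 R).inv₀ fun θ => circleMap_ne_center hR0.ne'
      have h3 : Continuous fun θ => deriv (circleMap 0 R) θ := by
        simp only [deriv_circleMap]
        exact (continuous_circleMap 0 R).mul continuous_const
      exact h3.smul ((h2.pow 2).smul h1)
    · refine Eventually.of_forall fun θ x hx => ?_
      refine DifferentiableAt.differentiableWithinAt ?_
      refine DifferentiableAt.fun_const_smul (DifferentiableAt.fun_const_smul ?_ _) _
      exact (hFd _ (hmem x hx _ (hcm θ))).comp x (differentiableAt_id.add_const _)
    · refine Eventually.of_forall fun θ x hx => ?_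
      have := hδb _ (ball_subset_ball (min_le_right _ _) (hmem' x hx _ (hcm θ)))
      simp only [norm_smul, deriv_circleMap, norm_mul, norm_circleMap_zero, Complex.norm_I,
        mul_one, sub_zero, norm_pow, norm_inv, abs_of_pos hR0]
      gcongr
    · exact integrable_const _
  refine this.congr_of_eventuallyEq ?_
  filter_upwards [ball_mem_nhds x₀ hr0] with x hx using key x hx

/-! ### The cut plane, the identity theorem and power series. -/

lemma mem_cutPlane_iff {z : ℂ} : z ∈ cutPlane ↔ ∀ x : ℝ, 1 ≤ x → (x : ℂ) ≠ z := by
  simp [cutPlane]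

lemma isOpen_cutPlane : IsOpen cutPlane :=
  (Complex.isometry_ofReal.isClosedEmbedding.isClosedMap _ isClosed_Ici).isOpen_compl

lemma mem_cutPlane_of_norm_le_one {z : ℂ} (hz : ‖z‖ ≤ 1) (h1 : z ≠ 1) : z ∈ cutPlane := by
  refine mem_cutPlane_iff.2 fun x hx h => h1 ?_
  rw [← h, Complex.norm_real, Real.norm_eq_abs] at hz
  have : x = 1 := le_antisymm ((le_abs_self x).trans hz) hx
  rw [← h, this, Complex.ofReal_one]

lemma mem_cutPlane_of_norm_lt_one {z : ℂ} (hz : ‖z‖ < 1) : z ∈ cutPlane :=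
  mem_cutPlane_of_norm_le_one hz.le (by rintro rfl; simp at hz)

lemma ball_subset_cutPlane : ball (0 : ℂ) 1 ⊆ cutPlane := fun _ hz =>
  mem_cutPlane_of_norm_lt_one (mem_ball_zero_iff.1 hz)

lemma one_sub_ne_zero_of_mem_cutPlane {z : ℂ} (hz : z ∈ cutPlane) : 1 - z ≠ 0 := fun h =>
  mem_cutPlane_iff.1 hz 1 le_rfl (by rw [Complex.ofReal_one]; exact sub_eq_zero.1 h)

lemma smul_mem_cutPlane {z : ℂ} (hz : z ∈ cutPlane) {t : ℝ} (h0 : 0 ≤ t) (h1 : t ≤ 1) :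
    (t : ℂ) * z ∈ cutPlane := by
  refine mem_cutPlane_iff.2 fun x hx h => ?_
  rcases h0.eq_or_lt with rfl | h0
  · rw [Complex.ofReal_zero, zero_mul, Complex.ofReal_eq_zero] at h
    linarith
  · refine mem_cutPlane_iff.1 hz (x / t) ?_ ?_
    · rw [le_div_iff₀ h0]; linarith
    · rw [Complex.ofReal_div, h, mul_div_cancel_left₀]
      exact_mod_cast h0.ne'

lemma isPreconnected_cutPlane : IsPreconnected cutPlane := by
  have h0 : (0 : ℂ) ∈ cutPlane := mem_cutPlane_of_norm_lt_one (by simp)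
  have : StarConvex ℝ (0 : ℂ) cutPlane := by
    rw [starConvex_zero_iff]
    intro z hz t ht0 ht1
    rw [Complex.real_smul]
    exact smul_mem_cutPlane hz ht0 ht1
  exact (this.isPathConnected h0).isConnected.isPreconnected

/-- Two holomorphic functions on the cut plane which agree on the unit disc are equal. -/
lemma eqOn_cutPlane {f g : ℂ → ℂ} (hf : DifferentiableOn ℂ f cutPlane)
    (hg : DifferentiableOn ℂ g cutPlane) (h : ∀ z : ℂ, ‖z‖ < 1 → f z = g z) :
    EqOn f g cutPlane := by
  refine (hf.analyticOnNhd isOpen_cutPlane).eqOn_of_preconnected_of_eventuallyEq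
    (hg.analyticOnNhd isOpen_cutPlane) isPreconnected_cutPlane
    (z₀ := 0) (mem_cutPlane_of_norm_lt_one (by simp)) ?_
  filter_upwards [ball_mem_nhds (0 : ℂ) one_pos] with z hz using h z (mem_ball_zero_iff.1 hz)

/-- Termwise differentiation of a power series in the unit disc. -/
lemma hasSum_deriv_powerSeries {c : ℕ → ℂ} {f : ℂ → ℂ}
    (h : ∀ z : ℂ, ‖z‖ < 1 → HasSum (fun n => c n * z ^ n) (f z)) {z : ℂ} (hz : ‖z‖ < 1) :
    HasSum (fun n : ℕ => c n * (n * z ^ (n - 1))) (deriv f z) := by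
  obtain ⟨ρ, hzρ, hρ⟩ := exists_between hz
  have hρ0 : 0 ≤ ρ := (norm_nonneg z).trans hzρ.le
  have hρn : ‖(ρ : ℂ)‖ = ρ := by rw [Complex.norm_real, Real.norm_eq_abs, abs_of_nonneg hρ0]
  have hmem : z ∈ ball (0 : ℂ) ρ := mem_ball_zero_iff.2 hzρ
  have key := Complex.hasSum_deriv_of_summable_norm (h ρ (by rwa [hρn])).summable.norm
    (F := fun n w => c n * w ^ n) (U := ball (0 : ℂ) ρ)
    (fun n => by fun_prop) isOpen_ball (fun n w hw => by
      rw [norm_mul, norm_mul, norm_pow, norm_pow, hρn]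
      have := (mem_ball_zero_iff.1 hw).le
      gcongr) hmem
  have h2 : deriv (fun w => ∑' n, c n * w ^ n) z = deriv f z := by
    refine Filter.EventuallyEq.deriv_eq ?_
    filter_upwards [isOpen_ball.mem_nhds hmem] with w hw
    exact (h w ((mem_ball_zero_iff.1 hw).trans hρ)).tsum_eq
  rw [h2] at key
  simpa using key

/-! ### Existence of the Lerch transcendent. -/

/-- `F` continues the Lerch series `∑ z ^ n / (n + u) ^ s` holomorphically to `z` in the cut plane
and `c < re s`. -/
structure IsHalfLerch (u c : ℝ) (F : ℂ × ℂ → ℂ) : Prop where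
  differentiableOn : DifferentiableOn ℂ F (cutPlane ×ˢ {s : ℂ | c < s.re})
  hasSum : ∀ z s : ℂ, ‖z‖ < 1 → c < s.re →
    HasSum (fun n : ℕ => z ^ n / (((n + u : ℝ) : ℂ) ^ s)) (F (z, s))

lemma isOpen_cutPlane_prod (c : ℝ) : IsOpen (cutPlane ×ˢ {s : ℂ | c < s.re}) :=
  isOpen_cutPlane.prod (isOpen_lt continuous_const Complex.continuous_re)

lemma IsHalfLerch.differentiableAt {u c : ℝ} {F : ℂ × ℂ → ℂ} (hF : IsHalfLerch u c F) {z s : ℂ}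
    (hz : z ∈ cutPlane) (hs : c < s.re) : DifferentiableAt ℂ F (z, s) :=
  hF.differentiableOn.differentiableAt ((isOpen_cutPlane_prod c).mem_nhds ⟨hz, hs⟩)

/-- The identity theorem in z alone, at fixed s; this is what lets continuations on different
half-planes be glued. -/
lemma IsHalfLerch.eq {u c c' : ℝ} {F F' : ℂ × ℂ → ℂ} (hF : IsHalfLerch u c F)
    (hF' : IsHalfLerch u c' F') {z s : ℂ} (hz : z ∈ cutPlane) (hs : c < s.re) (hs' : c' < s.re) :
    F (z, s) = F' (z, s) := by
  refine eqOn_cutPlane (f := fun w => F (w, s)) (g := fun w => F' (w, s)) ?_ ?_ ?_ hz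
  · exact hF.differentiableOn.comp (by fun_prop) fun w hw => ⟨hw, hs⟩
  · exact hF'.differentiableOn.comp (by fun_prop) fun w hw => ⟨hw, hs'⟩
  · exact fun w hw => (hF.hasSum w s hw hs).unique (hF'.hasSum w s hw hs')

lemma natCast_add_cpow_ne_zero {u : ℝ} (hu : 0 < u) (n : ℕ) (s : ℂ) :
    (((n + u : ℝ) : ℂ) ^ s) ≠ 0 := by
  have : ((n + u : ℝ) : ℂ) ≠ 0 := by exact_mod_cast (by positivity : (n + u : ℝ) ≠ 0)
  rw [Ne, Complex.cpow_eq_zero_iff]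
  exact fun h => this h.1

/-- The operator `z ∂/∂z + u` shifts the second variable of the Lerch series by `1`. -/
lemma IsHalfLerch.shift {u c : ℝ} (hu : 0 < u) {F : ℂ × ℂ → ℂ} (hF : IsHalfLerch u c F) :
    IsHalfLerch u (c - 1)
      (fun p => p.1 * fderiv ℂ F (p.1, p.2 + 1) (1, 0) + u * F (p.1, p.2 + 1)) where
  differentiableOn := by
    have hmaps : MapsTo (fun p : ℂ × ℂ => (p.1, p.2 + 1)) (cutPlane ×ˢ {s : ℂ | c - 1 < s.re})
        (cutPlane ×ˢ {s : ℂ | c < s.re}) := by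
      rintro ⟨z, s⟩ ⟨hz, hs⟩
      refine ⟨hz, ?_⟩
      simp only [mem_ofPred_eq, Complex.add_re, Complex.one_re] at hs ⊢
      linarith
    have h1 := (differentiableOn_fderiv_apply (isOpen_cutPlane_prod c) hF.differentiableOn
      (1, 0)).comp (f := fun p : ℂ × ℂ => (p.1, p.2 + 1)) (by fun_prop) hmaps
    have h2 := hF.differentiableOn.comp (f := fun p : ℂ × ℂ => (p.1, p.2 + 1)) (by fun_prop) hmaps
    exact (differentiableOn_fst.mul h1).add (h2.const_mul (u : ℂ))
  hasSum := by
    intro z s hz hs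
    have hs' : c < (s + 1).re := by
      rw [Complex.add_re, Complex.one_re]; linarith
    have hd : deriv (fun w => F (w, s + 1)) z = fderiv ℂ F (z, s + 1) (1, 0) := by
      have h1 : HasDerivAt (fun w : ℂ => (w, s + 1)) ((1, 0) : ℂ × ℂ) z :=
        (hasDerivAt_id z).prodMk (hasDerivAt_const z (s + 1))
      exact ((hF.differentiableAt (mem_cutPlane_of_norm_lt_one hz)
        hs').hasFDerivAt.comp_hasDerivAt z h1).deriv
    have h1 := hasSum_deriv_powerSeries (c := fun n => (((n + u : ℝ) : ℂ) ^ (s + 1))⁻¹)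
      (f := fun w => F (w, s + 1)) (fun w hw => by
        simpa only [div_eq_inv_mul] using hF.hasSum w (s + 1) hw hs') hz
    rw [hd] at h1
    have h2 := (h1.mul_left z).add ((hF.hasSum z (s + 1) hz hs').mul_left (u : ℂ))
    convert! h2 using 1
    funext n
    have hn : ((n + u : ℝ) : ℂ) ≠ 0 := by exact_mod_cast (by positivity : (n + u : ℝ) ≠ 0)
    have hs0 := natCast_add_cpow_ne_zero hu n s
    -- The truncated exponent at n = 0 is harmless, since the factor n vanishes.
    have hpow : z * ((n : ℂ) * z ^ (n - 1)) = n * z ^ n := by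
      rcases n with _ | n
      · simp
      · rw [Nat.add_sub_cancel, pow_succ]; ring
    rw [Complex.cpow_add _ _ hn, Complex.cpow_one, mul_left_comm z, hpow]
    field_simp
    push_cast
    ring

/-- The Lerch transcendent for `re s > 0`, as a Mellin transform. -/
def lerchMellin (u : ℝ) (p : ℂ × ℂ) : ℂ :=
  (Complex.Gamma p.2)⁻¹ *
    mellin (fun t : ℝ => (Real.exp (-u * t) : ℂ) * (1 - p.1 * Real.exp (-t))⁻¹) p.2

lemma one_sub_mul_ne_zero {z : ℂ} (hz : z ∈ cutPlane) {x : ℝ} (h0 : 0 ≤ x) (h1 : x ≤ 1) :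
    1 - z * x ≠ 0 := by
  rw [mul_comm]
  exact one_sub_ne_zero_of_mem_cutPlane (smul_mem_cutPlane hz h0 h1)

lemma differentiableAt_mellin_lerch {u : ℝ} (hu : 0 < u) {z₀ s₀ : ℂ} (hz₀ : z₀ ∈ cutPlane)
    (hs₀ : 0 < s₀.re) :
    DifferentiableAt ℂ (fun p : ℂ × ℂ =>
      mellin (fun t : ℝ => (Real.exp (-u * t) : ℂ) * (1 - p.1 * Real.exp (-t))⁻¹) p.2)
      (z₀, s₀) := by
  obtain ⟨ε, hε, hεU⟩ := Metric.isOpen_iff.1 isOpen_cutPlane z₀ hz₀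
  set r := min (ε / 2) (s₀.re / 2) with hr
  have hr0 : 0 < r := by positivity
  have hball : closedBall z₀ r ⊆ cutPlane := (closedBall_subset_ball (by
    have := min_le_left (ε / 2) (s₀.re / 2)
    linarith)).trans hεU
  obtain ⟨C, hC⟩ : ∃ C : ℝ, ∀ q ∈ closedBall z₀ r ×ˢ Icc (0 : ℝ) 1,
      ‖(1 - q.1 * (q.2 : ℂ))⁻¹‖ ≤ C := by
    refine ((isCompact_closedBall z₀ r).prod isCompact_Icc).exists_bound_of_continuousOn ?_
    refine ContinuousOn.inv₀ (by fun_prop) ?_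
    rintro ⟨z, x⟩ ⟨hz, hx⟩
    exact one_sub_mul_ne_zero (hball hz) hx.1 hx.2
  have hexp : ∀ t ∈ Ioi (0 : ℝ), Real.exp (-t) ∈ Icc (0 : ℝ) 1 := fun t ht =>
    ⟨(Real.exp_pos _).le, Real.exp_le_one_iff.2 (neg_nonpos.2 (le_of_lt ht))⟩
  have hfst : ∀ p ∈ ball (z₀, s₀) r, p.1 ∈ closedBall z₀ r := fun p hp => by
    rw [← ball_prod_same] at hp
    exact ball_subset_closedBall hp.1
  have hsnd : ∀ p ∈ ball (z₀, s₀) r, s₀.re / 2 ≤ p.2.re ∧ p.2.re ≤ 3 * s₀.re / 2 := fun p hp => by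
    rw [← ball_prod_same] at hp
    have h1 := mem_ball_iff_norm.1 hp.2
    have h2 := Complex.abs_re_le_norm (p.2 - s₀)
    rw [Complex.sub_re, abs_le] at h2
    have h3 := min_le_right (ε / 2) (s₀.re / 2)
    constructor <;> linarith [h2.1, h2.2]
  unfold mellin
  refine differentiableAt_integral_of_dominated hr0
    -- Near s₀ the real part of s stays between s₀.re / 2 and 3 s₀.re / 2. The lower exponent
    -- dominates for t ≤ 1, the upper one for t ≥ 1; C bounds the remaining factor by compactness.
    (bound := fun t => (t ^ (s₀.re / 2 - 1) * Real.exp (-u * t) +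
      t ^ (3 * s₀.re / 2 - 1) * Real.exp (-u * t)) * C) ?_ ?_ ?_ ?_
  · intro p hp
    refine ContinuousOn.aestronglyMeasurable ?_ measurableSet_Ioi
    have h1 : ContinuousOn (fun t : ℝ => 1 - p.1 * (Real.exp (-t) : ℂ)) (Ioi 0) := by fun_prop
    have h2 : ContinuousOn (fun t : ℝ => (Real.exp (-u * t) : ℂ)) (Ioi 0) := by fun_prop
    simp only [smul_eq_mul]
    refine ContinuousOn.mul (fun t ht => ?_) (h2.mul (h1.inv₀ fun t ht => ?_))
    · exact (Complex.continuousAt_ofReal_cpow_const t _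
        (Or.inr (ne_of_gt ht))).continuousWithinAt
    · exact one_sub_mul_ne_zero (hball (hfst p hp)) (hexp t ht).1 (hexp t ht).2
  · filter_upwards [ae_restrict_mem measurableSet_Ioi] with t ht p hp
    have ht0 : (t : ℂ) ≠ 0 := by exact_mod_cast (ne_of_gt ht)
    have h1 := one_sub_mul_ne_zero (hball (hfst p hp)) (hexp t ht).1 (hexp t ht).2
    have h2 : DifferentiableAt ℂ (fun p : ℂ × ℂ => 1 - p.1 * (Real.exp (-t) : ℂ)) p := by fun_prop
    refine DifferentiableAt.differentiableWithinAt ?_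
    refine DifferentiableAt.fun_smul ?_ ((h2.fun_inv h1).const_mul _)
    exact DifferentiableAt.const_cpow (by fun_prop) (Or.inl ht0)
  · filter_upwards [ae_restrict_mem measurableSet_Ioi] with t ht p hp
    have ht0 : (0 : ℝ) < t := ht
    rw [norm_smul, Complex.norm_cpow_eq_rpow_re_of_pos ht0, norm_mul, Complex.norm_real,
      Real.norm_of_nonneg (Real.exp_pos _).le, ← mul_assoc, ← add_mul]
    have h1 := hC (p.1, Real.exp (-t)) ⟨hfst p hp, hexp t ht⟩
    have h2 : t ^ (p.2 - 1).re ≤ t ^ (s₀.re / 2 - 1) + t ^ (3 * s₀.re / 2 - 1) := by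
      obtain ⟨h3, h4⟩ := hsnd p hp
      rw [Complex.sub_re, Complex.one_re]
      rcases le_total t 1 with h | h
      · exact (Real.rpow_le_rpow_of_exponent_ge ht0 h (by linarith)).trans
          (le_add_of_nonneg_right (by positivity))
      · exact (Real.rpow_le_rpow_of_exponent_le h (by linarith)).trans
          (le_add_of_nonneg_left (by positivity))
    gcongr
  · have hI : ∀ σ : ℝ, 0 < σ → IntegrableOn (fun t : ℝ => t ^ (σ - 1) * Real.exp (-u * t))
        (Ioi 0) := fun σ hσ => by
      simpa using integrableOn_rpow_mul_exp_neg_mul_rpow (p := 1) (s := σ - 1) (by linarith)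
        one_pos hu
    exact ((hI _ (by positivity)).add (hI _ (by positivity))).mul_const C

/-- Expand 1/(1 - z e^(-t)) geometrically: the Mellin transform of e^(-(n+u)t) is Γ(s)/(n+u)^s. -/
lemma isHalfLerch_lerchMellin {u : ℝ} (hu : 0 < u) : IsHalfLerch u 0 (lerchMellin u) where
  differentiableOn := by
    rintro ⟨z, s⟩ ⟨hz, hs⟩
    refine DifferentiableAt.differentiableWithinAt ?_
    exact (((Complex.differentiable_one_div_Gamma s).comp (z, s)
      (f := fun p : ℂ × ℂ => p.2) differentiableAt_snd)).mul
      (differentiableAt_mellin_lerch hu hz hs)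
  hasSum := by
    intro z s hz hs
    have hpos : ∀ n : ℕ, (0 : ℝ) < n + u := fun n => by positivity
    have h := hasSum_mellin (a := fun n : ℕ => z ^ n) (p := fun n : ℕ => (n + u : ℝ))
      (F := fun t : ℝ => (Real.exp (-u * t) : ℂ) * (1 - z * Real.exp (-t))⁻¹)
      (fun n => Or.inr (hpos n)) hs (fun t ht => ?_) ?_
    · have h2 := h.mul_left (Complex.Gamma s)⁻¹
      convert! h2 using 1
      funext n
      have := Complex.Gamma_ne_zero_of_re_pos hs
      field_simp
    · have hlt : ‖z * (Real.exp (-t) : ℂ)‖ < 1 := by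
        rw [norm_mul, Complex.norm_real, Real.norm_of_nonneg (Real.exp_pos _).le]
        have : Real.exp (-t) ≤ 1 := Real.exp_le_one_iff.2 (neg_nonpos.2 (le_of_lt ht))
        nlinarith [norm_nonneg z, Real.exp_pos (-t)]
      convert! (hasSum_geometric_of_norm_lt_one hlt).mul_left (Real.exp (-u * t) : ℂ) using 1
      funext n
      have : Real.exp (-(n + u) * t) = Real.exp (-u * t) * Real.exp (-t) ^ n := by
        rw [← Real.exp_nat_mul, ← Real.exp_add]
        congr 1; ring
      rw [this]
      push_cast
      ring
    · refine Summable.of_nonneg_of_le (fun n => by have := hpos n; positivity) (fun n => ?_)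
        ((summable_geometric_of_lt_one (norm_nonneg z) hz).div_const (u ^ s.re))
      rw [norm_pow]
      have : u ≤ n + u := by linarith [(Nat.cast_nonneg n : (0 : ℝ) ≤ n)]
      gcongr

lemma exists_isHalfLerch {u : ℝ} (hu : 0 < u) (k : ℕ) : ∃ F, IsHalfLerch u (-k) F := by
  induction k with
  | zero => exact ⟨_, by simpa using isHalfLerch_lerchMellin hu⟩
  | succ k ih =>
    obtain ⟨F, hF⟩ := ih
    have h := hF.shift hu
    rw [← neg_add', ← Nat.cast_succ] at h
    exact ⟨_, h⟩

theorem exists_isLerchContinuation {u : ℝ} (hu : 0 < u) : ∃ F, IsLerchContinuation u F := by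
  choose G hG using exists_isHalfLerch hu
  have hk : ∀ s : ℂ, -((⌈|s.re|⌉₊ + 1 : ℕ) : ℝ) < s.re := fun s => by
    push_cast
    linarith [Nat.le_ceil |s.re|, neg_abs_le s.re]
  -- The half-plane used varies with the point, but near a given point all choices agree with one
  -- fixed G by `IsHalfLerch.eq`.
  refine ⟨fun p => G (⌈|p.2.re|⌉₊ + 1) p, ?_, fun z s hz => (hG _).hasSum z s hz (hk s)⟩
  rintro ⟨z, s⟩ ⟨hz, -⟩
  refine DifferentiableAt.differentiableWithinAt ?_
  refine ((hG (⌈|s.re|⌉₊ + 1)).differentiableAt hz (hk s)).congr_of_eventuallyEq ?_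
  filter_upwards [(isOpen_cutPlane_prod _).mem_nhds ⟨hz, hk s⟩] with p hp
  exact (hG _).eq (hG _) hp.1 (hk p.2) hp.2

/-! ### Φ and its s-derivative as holomorphic functions of z and as series. -/

lemma isLerchContinuation_lerchPhi {u : ℝ} (hu : 0 < u) :
    IsLerchContinuation u (fun p : ℂ × ℂ => lerchPhi p.1 p.2 u) :=
  Classical.epsilon_spec (exists_isLerchContinuation hu)

lemma differentiableAt_lerchPhi {u : ℝ} (hu : 0 < u) {z : ℂ} (hz : z ∈ cutPlane) (s : ℂ) :
    DifferentiableAt ℂ (fun p : ℂ × ℂ => lerchPhi p.1 p.2 u) (z, s) :=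
  (isLerchContinuation_lerchPhi hu).1.differentiableAt
    ((isOpen_cutPlane.prod isOpen_univ).mem_nhds ⟨hz, mem_univ s⟩)

lemma differentiableOn_lerchPhi_left {u : ℝ} (hu : 0 < u) (s : ℂ) :
    DifferentiableOn ℂ (fun z => lerchPhi z s u) cutPlane :=
  (isLerchContinuation_lerchPhi hu).1.comp (f := fun z : ℂ => (z, s)) (by fun_prop)
    fun _ hz => ⟨hz, mem_univ s⟩

lemma lerchPhiDeriv_eq_fderiv {u : ℝ} (hu : 0 < u) {z : ℂ} (hz : z ∈ cutPlane) (s : ℂ) :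
    lerchPhiDeriv z s u = fderiv ℂ (fun p : ℂ × ℂ => lerchPhi p.1 p.2 u) (z, s) (0, 1) := by
  have h1 : HasDerivAt (fun w : ℂ => (z, w)) ((0, 1) : ℂ × ℂ) s :=
    (hasDerivAt_const s z).prodMk (hasDerivAt_id s)
  exact ((differentiableAt_lerchPhi hu hz s).hasFDerivAt.comp_hasDerivAt s h1).deriv

lemma differentiableOn_lerchPhiDeriv_left {u : ℝ} (hu : 0 < u) (s : ℂ) :
    DifferentiableOn ℂ (fun z => lerchPhiDeriv z s u) cutPlane := by
  have h := (differentiableOn_fderiv_apply (isOpen_cutPlane.prod isOpen_univ)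
    (isLerchContinuation_lerchPhi hu).1 (0, 1)).comp (f := fun z : ℂ => (z, s))
    (s := cutPlane) (by fun_prop) fun _ hz => ⟨hz, mem_univ s⟩
  exact h.congr fun z hz => lerchPhiDeriv_eq_fderiv hu hz s

lemma hasSum_lerchPhi {u : ℝ} (hu : 0 < u) {z : ℂ} (hz : ‖z‖ < 1) (s : ℂ) :
    HasSum (fun n : ℕ => z ^ n / (((n + u : ℝ) : ℂ) ^ s)) (lerchPhi z s u) :=
  (isLerchContinuation_lerchPhi hu).2 z s hz

lemma hasSum_lerchPhiDeriv {u : ℝ} (hu : 0 < u) {z : ℂ} (hz : ‖z‖ < 1) (s : ℂ) :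
    HasSum (fun n : ℕ => -(Real.log (n + u) : ℂ) * (z ^ n / (((n + u : ℝ) : ℂ) ^ s)))
      (lerchPhiDeriv z s u) := by
  have hpos : ∀ n : ℕ, (0 : ℝ) < n + u := fun n => by positivity
  have hne : ∀ n : ℕ, ((n + u : ℝ) : ℂ) ≠ 0 := fun n => by exact_mod_cast (hpos n).ne'
  have hder : ∀ (n : ℕ) (w : ℂ), HasDerivAt (fun w => z ^ n / (((n + u : ℝ) : ℂ) ^ w))
      (-(Real.log (n + u) : ℂ) * (z ^ n / (((n + u : ℝ) : ℂ) ^ w))) w := by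
    intro n w
    have h := ((hasDerivAt_id w).neg.const_cpow (c := ((n + u : ℝ) : ℂ)) (Or.inl (hne n))).const_mul
      (z ^ n)
    simp only [Pi.neg_apply, id, Complex.cpow_neg] at h
    convert! h using 1
    rw [Complex.ofReal_log (hpos n).le]
    ring
  have hnorm : ∀ (n : ℕ) (w : ℂ),
      ‖z ^ n / (((n + u : ℝ) : ℂ) ^ w)‖ = ‖z‖ ^ n / (n + u : ℝ) ^ w.re := fun n w => by
    rw [norm_div, norm_pow, Complex.norm_cpow_eq_rpow_re_of_pos (hpos n)]
  have hsum : ∀ w : ℂ, Summable fun n : ℕ => ‖z‖ ^ n / (n + u : ℝ) ^ w.re := fun w => by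
    simpa only [hnorm] using (hasSum_lerchPhi hu hz w).summable.norm
  -- For |w - s| < 1 and x > 0, x^(-Re w) is at most x^(-Re(s-1)) + x^(-Re(s+1)), with either term
  -- sufficing according to whether x ≥ 1 or x ≤ 1.
  have key := Complex.hasSum_deriv_of_summable_norm ((hsum (s - 1)).add (hsum (s + 1)))
    (F := fun (n : ℕ) w => z ^ n / (((n + u : ℝ) : ℂ) ^ w)) (U := ball s 1)
    (fun n w _ => (hder n w).differentiableAt.differentiableWithinAt) isOpen_ball
    (fun n w hw => by
      have h1 := Complex.abs_re_le_norm (w - s)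
      rw [Complex.sub_re, abs_le] at h1
      have h2 := mem_ball_iff_norm.1 hw
      have h0 := hpos n
      rw [hnorm, ← mul_one_div, ← mul_one_div _ ((n + u : ℝ) ^ (s - 1).re),
        ← mul_one_div _ ((n + u : ℝ) ^ (s + 1).re), ← mul_add]
      gcongr
      simp only [one_div, ← Real.rpow_neg h0.le, Complex.sub_re, Complex.add_re, Complex.one_re]
      rcases le_total (n + u : ℝ) 1 with h | h
      · exact (Real.rpow_le_rpow_of_exponent_ge h0 h (by linarith)).trans
          (le_add_of_nonneg_left (by positivity))
      · exact (Real.rpow_le_rpow_of_exponent_le h (by linarith)).trans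
          (le_add_of_nonneg_right (by positivity)))
    (mem_ball_self one_pos)
  simp only [(hder _ _).deriv, fun w => (hasSum_lerchPhi hu hz w).tsum_eq] at key
  exact key

/-! ### The continuation of γ and its derivative. -/

lemma coeff_eq {a b : ℝ} (ha : 0 < a) (hb : 0 < b) (n : ℕ) :
    coeff a b n = 1 / a * (n + b / a)⁻¹ + Real.log (n + b / a) - Real.log (n + (b + 1) / a) := by
  have h1 : a * n + b = a * (n + b / a) := by field_simp
  have h2 : a * n + b + 1 = a * (n + (b + 1) / a) := by field_simp; ring
  rw [coeff, h2, h1, mul_div_mul_left _ _ ha.ne', Real.log_div (by positivity) (by positivity)]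
  field_simp
  ring

lemma coeff_nonneg {a b : ℝ} (ha : 0 < a) (hb : 0 < b) (n : ℕ) : 0 ≤ coeff a b n := by
  have hx : 0 < a * n + b := by positivity
  rw [coeff, sub_nonneg]
  refine (Real.log_le_sub_one_of_pos (by positivity)).trans (le_of_eq ?_)
  field_simp
  ring

/-- The expression of `γ_{a,b}` by Lerch transcendents. -/
def gammaLerch (a b : ℝ) (z : ℂ) : ℂ :=
  1 / (a : ℂ) * lerchPhi z 1 (b / a) - lerchPhiDeriv z 0 (b / a) + lerchPhiDeriv z 0 ((b + 1) / a)

lemma isGammaContinuation_gammaLerch {a b : ℝ} (ha : 0 < a) (hb : 0 < b) :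
    IsGammaContinuation a b (gammaLerch a b) := by
  have hu : 0 < b / a := by positivity
  have hv : 0 < (b + 1) / a := by positivity
  refine ⟨?_, fun z hz => ?_⟩
  · exact (((differentiableOn_lerchPhi_left hu 1).const_mul _).sub
      (differentiableOn_lerchPhiDeriv_left hu 0)).add (differentiableOn_lerchPhiDeriv_left hv 0)
  · convert! (((hasSum_lerchPhi hu hz 1).mul_left (1 / (a : ℂ))).sub
      (hasSum_lerchPhiDeriv hu hz 0)).add (hasSum_lerchPhiDeriv hv hz 0) using 1
    funext n
    rw [coeff_eq ha hb, Complex.cpow_one, Complex.cpow_zero, Complex.cpow_zero]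
    push_cast
    ring

/-- The expression of the derivative of `γ_{a,b}` by Lerch transcendents. -/
def gammaLerchDeriv (a b : ℝ) (z : ℂ) : ℂ :=
  -((b : ℂ) / (a : ℂ) ^ 2) * lerchPhi z 1 (b / a + 1)
    + 1 / ((a : ℂ) * (1 - z))
    + (b : ℂ) / (a : ℂ) * lerchPhiDeriv z 0 (b / a + 1)
    - lerchPhiDeriv z (-1) (b / a + 1)
    - ((b : ℂ) + 1) / (a : ℂ) * lerchPhiDeriv z 0 ((b + 1) / a + 1)
    + lerchPhiDeriv z (-1) ((b + 1) / a + 1)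

lemma deriv_gammaLerch {a b : ℝ} (ha : 0 < a) (hb : 0 < b) {z : ℂ} (hz : z ∈ cutPlane) :
    deriv (gammaLerch a b) z = gammaLerchDeriv a b z := by
  have hu : 0 < b / a + 1 := by positivity
  have hv : 0 < (b + 1) / a + 1 := by positivity
  have hG := isGammaContinuation_gammaLerch ha hb
  have haC : (a : ℂ) ≠ 0 := by exact_mod_cast ha.ne'
  refine eqOn_cutPlane (hG.1.deriv isOpen_cutPlane) ?_ (fun w hw => ?_) hz
  · have h1 : DifferentiableOn ℂ (fun z : ℂ => 1 / ((a : ℂ) * (1 - z))) cutPlane := by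
      refine DifferentiableOn.fun_div (by fun_prop) (by fun_prop) fun w hw => ?_
      exact mul_ne_zero haC (one_sub_ne_zero_of_mem_cutPlane hw)
    exact ((((((differentiableOn_lerchPhi_left hu 1).const_mul _).add h1).add
      ((differentiableOn_lerchPhiDeriv_left hu 0).const_mul _)).sub
      (differentiableOn_lerchPhiDeriv_left hu (-1))).sub
      ((differentiableOn_lerchPhiDeriv_left hv 0).const_mul _)).add
      (differentiableOn_lerchPhiDeriv_left hv (-1))
  · have h1 := hasSum_deriv_powerSeries hG.2 hw
    -- The n = 0 term of the derivative vanishes; dropping it shifts u and v to u + 1 and v + 1.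
    rw [← hasSum_nat_add_iff' 1] at h1
    simp only [Finset.sum_range_one, Nat.cast_zero, zero_mul, mul_zero, sub_zero,
      Nat.add_sub_cancel] at h1
    refine h1.unique ?_
    have hgeo := (hasSum_geometric_of_norm_lt_one hw).mul_left (1 / (a : ℂ))
    rw [← one_div, one_div_mul_one_div] at hgeo
    convert! ((((((hasSum_lerchPhi hu hw 1).mul_left (-((b : ℂ) / (a : ℂ) ^ 2))).add hgeo).add
      ((hasSum_lerchPhiDeriv hu hw 0).mul_left ((b : ℂ) / (a : ℂ)))).sub
      (hasSum_lerchPhiDeriv hu hw (-1))).sub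
      ((hasSum_lerchPhiDeriv hv hw 0).mul_left (((b : ℂ) + 1) / (a : ℂ)))).add
      (hasSum_lerchPhiDeriv hv hw (-1)) using 1
    funext n
    have e1 : ((n + 1 : ℕ) : ℝ) + b / a = n + (b / a + 1) := by push_cast; ring
    have e2 : ((n + 1 : ℕ) : ℝ) + (b + 1) / a = n + ((b + 1) / a + 1) := by push_cast; ring
    have hne : (n : ℂ) + ((b : ℂ) / a + 1) ≠ 0 := by
      exact_mod_cast (by positivity : (n : ℝ) + (b / a + 1) ≠ 0)
    rw [coeff_eq ha hb, e1, e2]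
    simp only [Complex.cpow_one, Complex.cpow_zero, Complex.cpow_neg_one]
    push_cast
    generalize (Real.log (n + (b / a + 1)) : ℂ) = l₁
    generalize (Real.log (n + ((b + 1) / a + 1)) : ℂ) = l₂
    -- Writing the factor n + 1 as x - b/a, and likewise for v, splits the coefficient into a
    -- constant 1/a (the geometric series), terms at s = 0 and s = 1, and terms x log x at s = -1.
    generalize hx : (n : ℂ) + ((b : ℂ) / a + 1) = x at hne ⊢
    have hn : (n : ℂ) = x - ((b : ℂ) / a + 1) := by rw [← hx]; ring
    rw [hn]
    field_simp
    ring

lemma hasSum_gammaFun {a b : ℝ} (hs : Summable (coeff a b)) (hn : ∀ n, 0 ≤ coeff a b n) {z : ℂ}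
    (hz : ‖z‖ ≤ 1) : HasSum (fun n : ℕ => (coeff a b n : ℂ) * z ^ n) (gammaFun a b z) := by
  rw [gammaFun, if_pos hz]
  refine (Summable.of_norm_bounded hs fun n => ?_).hasSum
  rw [norm_mul, norm_pow, Complex.norm_real, Real.norm_of_nonneg (hn n)]
  exact mul_le_of_le_one_right (hn n) (pow_le_one₀ (norm_nonneg z) hz)

/-- Outside the closed disc this is uniqueness of continuation. Inside it `gammaFun` is the series,
continuous up to the boundary by the Weierstrass test, so boundary points follow as limits from the
open disc. -/
lemma gammaFun_eq_gammaLerch {a b : ℝ} (ha : 0 < a) (hb : 0 < b) (hs : Summable (coeff a b))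
    {z : ℂ} (hz : z ∈ cutPlane) : gammaFun a b z = gammaLerch a b z := by
  have hG := isGammaContinuation_gammaLerch ha hb
  have hn := coeff_nonneg ha hb
  by_cases h1 : ‖z‖ ≤ 1
  · have hcont : ContinuousOn (fun w : ℂ => ∑' n, (coeff a b n : ℂ) * w ^ n)
        (closedBall 0 1) := by
      refine continuousOn_tsum (fun n => by fun_prop) hs fun n w hw => ?_
      rw [norm_mul, norm_pow, Complex.norm_real, Real.norm_of_nonneg (hn n)]
      exact mul_le_of_le_one_right (hn n)
        (pow_le_one₀ (norm_nonneg w) (mem_closedBall_zero_iff.1 hw))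
    have hzb : z ∈ closure (ball (0 : ℂ) 1) := by
      rwa [closure_ball _ one_ne_zero, mem_closedBall_zero_iff]
    have : (𝓝[ball (0 : ℂ) 1] z).NeBot := mem_closure_iff_nhdsWithin_neBot.1 hzb
    have l1 : Tendsto (fun w : ℂ => ∑' n, (coeff a b n : ℂ) * w ^ n) (𝓝[ball (0 : ℂ) 1] z)
        (𝓝 (∑' n, (coeff a b n : ℂ) * z ^ n)) :=
      (hcont z (mem_closedBall_zero_iff.2 h1)).mono_left (nhdsWithin_mono _ ball_subset_closedBall)
    have l2 : Tendsto (gammaLerch a b) (𝓝[ball (0 : ℂ) 1] z) (𝓝 (gammaLerch a b z)) :=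
      (hG.1.continuousOn z hz).mono_left (nhdsWithin_mono _ ball_subset_cutPlane)
    rw [gammaFun, if_pos h1]
    refine tendsto_nhds_unique (l1.congr' ?_) l2
    filter_upwards [self_mem_nhdsWithin] with w hw
    exact (hG.2 w (mem_ball_zero_iff.1 hw)).tsum_eq
  · rw [gammaFun, if_neg h1]
    have hE : IsGammaContinuation a b (Classical.epsilon (IsGammaContinuation a b)) :=
      Classical.epsilon_spec ⟨_, hG⟩
    exact eqOn_cutPlane hE.1 hG.1 (fun w hw => (hE.2 w hw).unique (hG.2 w hw)) hz

/-! ### The digamma function and the value at 1. -/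

lemma digamma_ofReal {x : ℝ} (hx : 0 < x) :
    Complex.digamma (x : ℂ) = (deriv (Real.log ∘ Real.Gamma) x : ℝ) := by
  have hd : DifferentiableAt ℂ Complex.Gamma x := Complex.differentiableAt_Gamma _ fun m h => by
    have h' : x = -m := by exact_mod_cast h
    linarith [(Nat.cast_nonneg m : (0 : ℝ) ≤ m)]
  have hr : DifferentiableAt ℝ Real.Gamma x :=
    Real.differentiableOn_Gamma_Ioi.differentiableAt (Ioi_mem_nhds hx)
  have h1 : deriv Complex.Gamma x = (deriv Real.Gamma x : ℝ) := by
    have h2 := hd.hasDerivAt.comp_ofReal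
    simp only [Complex.Gamma_ofReal] at h2
    exact h2.unique hr.hasDerivAt.ofReal_comp
  rw [Complex.digamma_def, logDeriv_apply, h1, Complex.Gamma_ofReal, Function.comp_def,
    deriv.log hr (Real.Gamma_pos_of_pos hx).ne', Complex.ofReal_div]

lemma tendsto_log_natCast_add_sub_log (c : ℝ) :
    Tendsto (fun n : ℕ => Real.log (n + c) - Real.log n) atTop (𝓝 0) := by
  have h1 : Tendsto (fun n : ℕ => 1 + c / (n : ℝ)) atTop (𝓝 1) := by
    simpa using (tendsto_const_div_atTop_nhds_zero_nat c).const_add 1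
  have h2 := ((Real.continuousAt_log one_ne_zero).tendsto.comp h1)
  rw [Real.log_one] at h2
  refine h2.congr' ?_
  filter_upwards [eventually_gt_atTop 0,
    tendsto_natCast_atTop_atTop.eventually (eventually_gt_atTop (-c))] with n hn hc
  have hn' : (0 : ℝ) < n := by exact_mod_cast hn
  rw [← Real.log_div (by linarith) hn'.ne', Function.comp_apply]
  congr 1
  field_simp

/-- The digamma function as a limit. -/
lemma tendsto_log_sub_sum_inv {u : ℝ} (hu : 0 < u) :
    Tendsto (fun n : ℕ => Real.log n - ∑ m ∈ Finset.range (n + 1), (m + u)⁻¹) atTop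
      (𝓝 (deriv (Real.log ∘ Real.Gamma) u)) := by
  set f := Real.log ∘ Real.Gamma with hf
  have hc : ConvexOn ℝ (Ioi 0) f := Real.convexOn_log_Gamma
  have h_rec (x : ℝ) (hx : 0 < x) : f (x + 1) = f x + Real.log x := by
    simp only [f, Function.comp_apply, Real.Gamma_add_one hx.ne',
      Real.log_mul hx.ne' (Real.Gamma_pos_of_pos hx).ne', add_comm]
  have hder {x : ℝ} (hx : 0 < x) : DifferentiableAt ℝ f x :=
    (Real.differentiableOn_Gamma_Ioi.differentiableAt (Ioi_mem_nhds hx)).log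
      (Real.Gamma_pos_of_pos hx).ne'
  have hder_rec (x : ℝ) (hx : 0 < x) : deriv f (x + 1) = deriv f x + x⁻¹ := by
    rw [← deriv_comp_add_const, ← Real.deriv_log,
      ← deriv_add (hder hx) (Real.differentiableAt_log hx.ne')]
    apply EventuallyEq.deriv_eq
    filter_upwards [eventually_gt_nhds hx] using h_rec
  have hsum (n : ℕ) : deriv f (n + u) = deriv f u + ∑ m ∈ Finset.range n, (m + u)⁻¹ := by
    induction n with
    | zero => simp
    | succ n hn =>
      rw [Nat.cast_succ, add_right_comm, hder_rec _ (by positivity), hn, Finset.sum_range_succ,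
        add_assoc]
  -- The slope of log Γ over [x, x+1] is log x; convexity places it between the derivatives at the
  -- two ends.
  have hlb (x : ℝ) (hx : 0 < x) : Real.log x ≤ deriv f (x + 1) := by
    refine (le_of_eq ?_).trans (hc.slope_le_deriv (mem_Ioi.2 hx)
      (mem_Ioi.2 (by linarith : 0 < x + 1)) (by linarith) (hder (by linarith)))
    rw [slope_def_field, h_rec x hx]
    simp
  have hub (x : ℝ) (hx : 0 < x) : deriv f x ≤ Real.log x := by
    refine (hc.deriv_le_slope (mem_Ioi.2 hx) (mem_Ioi.2 (by linarith : 0 < x + 1)) (by linarith)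
      (hder hx)).trans (le_of_eq ?_)
    rw [slope_def_field, h_rec x hx]
    simp
  have hlim : Tendsto (fun n : ℕ => deriv f (n + u + 1) - Real.log n) atTop (𝓝 0) := by
    refine tendsto_of_tendsto_of_tendsto_of_le_of_le (tendsto_log_natCast_add_sub_log u)
      (tendsto_log_natCast_add_sub_log (u + 1)) (fun n => ?_) (fun n => ?_)
    · exact sub_le_sub_right (hlb _ (by positivity)) _
    · simp only [← add_assoc]
      exact sub_le_sub_right (hub _ (by positivity)) _
  have h := hlim.const_sub (deriv f u)
  rw [sub_zero] at h
  refine h.congr fun n => ?_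
  have := hsum (n + 1)
  rw [Nat.cast_succ, add_right_comm] at this
  rw [this]
  ring

/-- The log n terms of the three limits cancel because v - u = 1/a, as do the log n! terms. All
three sequences sum over m ≤ n, hence the index shift by 1. -/
lemma hasSum_coeff {a b : ℝ} (ha : 0 < a) (hb : 0 < b) :
    HasSum (coeff a b) (Real.log (Real.Gamma ((b + 1) / a)) - Real.log (Real.Gamma (b / a))
      - 1 / a * deriv (Real.log ∘ Real.Gamma) (b / a)) := by
  have hu : 0 < b / a := by positivity
  have hv : 0 < (b + 1) / a := by positivity
  rw [hasSum_iff_tendsto_nat_of_nonneg (coeff_nonneg ha hb), ← tendsto_add_atTop_iff_nat 1]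
  refine (((Real.BohrMollerup.tendsto_log_gamma hv).sub
    (Real.BohrMollerup.tendsto_log_gamma hu)).sub
    ((tendsto_log_sub_sum_inv hu).const_mul (1 / a))).congr fun n => ?_
  simp only [coeff_eq ha hb, Finset.sum_add_distrib, Finset.sum_sub_distrib,
    Real.BohrMollerup.logGammaSeq, ← Finset.mul_sum, add_comm _ (b / a), add_comm _ ((b + 1) / a)]
  field_simp
  ring

end EulerLerch

end

theorem corollary1p1 (a b : ℝ) (ha : 0 < a) (hb : 0 < b) :
    -- the functions in the formulas are well defined: the series of `γ_{a,b}` converges on the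
    -- closed unit disc, and both analytic continuations exist
    (∀ z : ℂ, ‖z‖ ≤ 1 →
      HasSum (fun n : ℕ => (EulerLerch.coeff a b n : ℂ) * z ^ n) (EulerLerch.gammaFun a b z)) ∧
    DifferentiableOn ℂ (EulerLerch.gammaFun a b) EulerLerch.cutPlane ∧
    (∀ u : ℝ, 0 < u →
      EulerLerch.IsLerchContinuation u (fun p : ℂ × ℂ => EulerLerch.lerchPhi p.1 p.2 u)) ∧
    -- the value at `1`
    EulerLerch.gammaFun a b 1 =
      (Real.log (Real.Gamma ((b + 1) / a)) : ℂ) - (Real.log (Real.Gamma (b / a)) : ℂ)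
        - 1 / (a : ℂ) * Complex.digamma ((b / a : ℝ) : ℂ) ∧
    -- the values of `γ_{a,b}` and of its derivative on the cut plane
    ∀ z : ℂ, z ∈ EulerLerch.cutPlane →
      EulerLerch.gammaFun a b z =
        1 / (a : ℂ) * EulerLerch.lerchPhi z 1 (b / a)
          - EulerLerch.lerchPhiDeriv z 0 (b / a)
          + EulerLerch.lerchPhiDeriv z 0 ((b + 1) / a) ∧
      HasDerivAt (EulerLerch.gammaFun a b)
        (-((b : ℂ) / (a : ℂ) ^ 2) * EulerLerch.lerchPhi z 1 (b / a + 1)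
          + 1 / ((a : ℂ) * (1 - z))
          + (b : ℂ) / (a : ℂ) * EulerLerch.lerchPhiDeriv z 0 (b / a + 1)
          - EulerLerch.lerchPhiDeriv z (-1) (b / a + 1)
          - ((b : ℂ) + 1) / (a : ℂ) * EulerLerch.lerchPhiDeriv z 0 ((b + 1) / a + 1)
          + EulerLerch.lerchPhiDeriv z (-1) ((b + 1) / a + 1)) z := by
  have hs := EulerLerch.hasSum_coeff ha hb
  have hn := EulerLerch.coeff_nonneg ha hb
  refine ⟨fun z hz => EulerLerch.hasSum_gammaFun hs.summable hn hz, ?_,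
    fun u hu => EulerLerch.isLerchContinuation_lerchPhi hu, ?_, fun z hz => ⟨?_, ?_⟩⟩
  · exact (EulerLerch.isGammaContinuation_gammaLerch ha hb).1.congr fun z hz =>
      EulerLerch.gammaFun_eq_gammaLerch ha hb hs.summable hz
  · have h1 := EulerLerch.hasSum_gammaFun hs.summable hn (z := 1) (by simp)
    simp only [one_pow, mul_one] at h1
    rw [h1.unique (Complex.hasSum_ofReal.2 hs),
      EulerLerch.digamma_ofReal (by positivity : 0 < b / a)]
    push_cast
    ring
  · exact EulerLerch.gammaFun_eq_gammaLerch ha hb hs.summable hz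
  · have hd : DifferentiableAt ℂ (EulerLerch.gammaLerch a b) z :=
      (EulerLerch.isGammaContinuation_gammaLerch ha hb).1.differentiableAt
        (EulerLerch.isOpen_cutPlane.mem_nhds hz)
    have h := hd.hasDerivAt
    rw [EulerLerch.deriv_gammaLerch ha hb hz] at h
    refine h.congr_of_eventuallyEq ?_
    filter_upwards [EulerLerch.isOpen_cutPlane.mem_nhds hz] with w hw
    exact EulerLerch.gammaFun_eq_gammaLerch ha hb hs.summable hw
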